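/- Let $T'$ be a complete first-order theory in a countable language $L'$ (function, constant and relation symbols are allowed), and suppose that $T'$ is $\omega$-categorical, i.e. any two countably infinite models of $T'$ are isomorphic. Let $n\ge 1$ and suppose that $T'$ is $n$-ary. Let $T$ be a restriction (reduct) of $T'$ to a sublanguage $L\subseteq L'$, i.e. an $L$-sentence is a consequence of $T$ if and only if it is a consequence of $T'$. Then $T$ is almost unary-tizable, i.e. $T$ has an expansion that is almost $1$-ary. Here the following definitions are used. * Two formulas are equivalent in a theory $S$ if they have the same realizations in every model of $S$. A formula "with $n$ free variables" is one with at most $n$ free variables. * $S$ is *$n$-ary* ($n\ge 1$) if every formula of the language of $S$ is equivalent in $S$ to a Boolean combination of formulas each of which has $n$ free variables; for $n=1$, formulas $x\approx y$ with $x,y$ variables are also allowed in the Boolean combination. * An *$n$-formula* of $S$ is a formula equivalent in $S$ to a Boolean combination of formulas each of which has $n$ free variables. * $S$ is *almost $n$-ary* if there are finitely many formulas $\varphi_1(\overline x),\dots,\varphi_m(\overline x)$ such that every formula is equivalent in $S$ to a Boolean combination of $n$-formulas of $S$ and of formulas obtained from $\varphi_1,\dots,\varphi_m$ by substituting variables (not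 necessarily distinct) for the free variables. * An *expansion* of $T$ is a complete theory $T''$ in a language containing $L$ whose restriction to $L$ is $T$. -/

import Mathlib

universe u v

namespace FirstOrder.Language

variable {L : Language.{u, v}}

/-- `BooleanCombination S φ`: the formula `φ` is built from formulas of `S` by means of
falsity, negation, conjunction and disjunction. Variables are indexed by `ℕ`. -/
inductive BooleanCombination (S : Set (L.Formula ℕ)) : L.Formula ℕ → Prop
  | of (φ : L.Formula ℕ) : φ ∈ S → BooleanCombination S φ
  | falsum : BooleanCombination S ⊥
  | not (φ : L.Formula ℕ) : BooleanCombination S φ → BooleanCombination S φ.not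
  | inf (φ ψ : L.Formula ℕ) :
      BooleanCombination S φ → BooleanCombination S ψ → BooleanCombination S (φ ⊓ ψ)
  | sup (φ ψ : L.Formula ℕ) :
      BooleanCombination S φ → BooleanCombination S ψ → BooleanCombination S (φ ⊔ ψ)

/-- The formulas with (at most) `n` free variables. -/
def formulasWithFreeVars (L : Language.{u, v}) (n : ℕ) : Set (L.Formula ℕ) :=
  {φ | φ.freeVarFinset.card ≤ n}

/-- The formulas `x ≈ y`, where `x` and `y` are variables. -/
def variableEqualities (L : Language.{u, v}) : Set (L.Formula ℕ) :=
  {φ | ∃ i j : ℕ, φ = (Term.var i : L.Term ℕ).equal (Term.var j)}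

/-- The formulas obtained from members of `Φ` by substituting variables (not necessarily
distinct) for their free variables. -/
def substitutionInstances (Φ : Set (L.Formula ℕ)) : Set (L.Formula ℕ) :=
  {φ | ∃ ψ ∈ Φ, ∃ f : ℕ → ℕ, φ = Formula.relabel f ψ}

namespace Theory

/-- Every formula is `T`-equivalent to a Boolean combination of formulas from `Δ`. -/
def IsBasedOn (T : L.Theory) (Δ : Set (L.Formula ℕ)) : Prop :=
  ∀ φ : L.Formula ℕ, ∃ ψ : L.Formula ℕ, BooleanCombination Δ ψ ∧ T.Iff φ ψ

/-- The `n`-formulas of `T`: the formulas that are `T`-equivalent to a Boolean combination of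
formulas with `n` free variables. -/
def nFormulas (T : L.Theory) (n : ℕ) : Set (L.Formula ℕ) :=
  {φ | ∃ ψ : L.Formula ℕ, BooleanCombination (L.formulasWithFreeVars n) ψ ∧ T.Iff φ ψ}

/-- `T` is `n`-ary. In the unary case `n = 1` the formulas `x ≈ y` are allowed
in the Boolean combinations besides the formulas with one free variable. -/
def IsNAry (T : L.Theory) (n : ℕ) : Prop :=
  T.IsBasedOn (L.formulasWithFreeVars n ∪ {φ | n = 1 ∧ φ ∈ L.variableEqualities})

/-- `T` is almost `n`-ary: some finite set `Φ` of formulas witnesses that each formula is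
`T`-equivalent to a Boolean combination of `n`-formulas and substitution instances of
members of `Φ`. -/
def IsAlmostNAry (T : L.Theory) (n : ℕ) : Prop :=
  ∃ Φ : Set (L.Formula ℕ), Φ.Finite ∧ T.IsBasedOn (T.nFormulas n ∪ substitutionInstances Φ)

/-- `T` is the restriction of `T'` to the language `L`, which is viewed as a sublanguage of `L'`
through the injective map `ι`; equivalently, `T'` is an expansion of `T`. The theories are compared
through the sentences they entail, so neither has to be deductively closed as a set. -/
def IsRestriction {L' : Language.{u, v}} (ι : L →ᴸ L') (T : L.Theory) (T' : L'.Theory) : Prop :=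
  ι.Injective ∧ ∀ σ : L.Sentence, T ⊨ᵇ σ ↔ T' ⊨ᵇ ι.onSentence σ

/-- `T` is almost `n`-aritizable: some expansion of `T` to a complete theory is almost `n`-ary. -/
def IsAlmostNAritizable (T : L.Theory) (n : ℕ) : Prop :=
  ∃ (L'' : Language.{u, v}) (ι : L →ᴸ L'') (T'' : L''.Theory),
    T''.IsComplete ∧ IsRestriction ι T T'' ∧ T''.IsAlmostNAry n

/-- Almost unary-tizable theories. -/
def IsAlmostUnaryTizable (T : L.Theory) : Prop :=
  T.IsAlmostNAritizable 1

end Theory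

end FirstOrder.Language

/-! The theory `T'` itself is the required expansion. By Ryll-Nardzewski it has only finitely many
formulas in `n` variables up to equivalence, so every formula with at most `n` free variables is
equivalent to a substitution instance of one of a finite list. Adding `x ≈ y` to the list covers the
equalities allowed when `n = 1`, and `n`-arity of `T'` becomes almost unarity.

Ryll-Nardzewski rests on omitting types: a non-isolated type realized in the countably infinite
model would be omitted in another one, against categoricity. So all `n`-types there are isolated,
and compactness leaves finitely many of them. -/

namespace FirstOrder.Language

open Cardinal

namespace Theory

variable {L : Language.{u, v}} {T : L.Theory}

/-! ### Compactness and transfer between models -/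

/-- Compactness for sets of formulas: a finitely realized set of formulas is realized. -/
theorem exists_realize_of_finitely_realized {α : Type} {Γ : Set (L.Formula α)}
    (h : ∀ s : Finset (L.Formula α), (∀ φ ∈ s, φ ∈ Γ) →
      ∃ (M : ModelType.{u, v, max u v} T) (v : α → M), ∀ φ ∈ s, φ.Realize v) :
    ∃ (M : ModelType.{u, v, max u v} T) (v : α → M), ∀ φ ∈ Γ, φ.Realize v := by
  classical
  have hsat : ((L.lhomWithConstants α).onTheory T ∪ Formula.equivSentence '' Γ).IsSatisfiable := by
    rw [isSatisfiable_iff_isFinitelySatisfiable]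
    intro T₀ hT₀
    obtain ⟨M, v, hv⟩ := h ((T₀.image Formula.equivSentence.symm).filter (· ∈ Γ))
      fun φ hφ => (Finset.mem_filter.1 hφ).2
    let : (constantsOn α).Structure M := constantsOn.structure v
    have hT : M ⊨ (L.lhomWithConstants α).onTheory T :=
      (LHom.onTheory_model _ _).2 inferInstance
    have hM : M ⊨ (T₀ : L[[α]].Theory) := by
      refine ⟨fun σ hσ => ?_⟩
      rcases hT₀ hσ with hσT | ⟨φ, hφ, rfl⟩
      · exact realize_sentence_of_mem _ hσT
      · refine (Formula.realize_equivSentence M φ).2 (hv φ ?_)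
        exact Finset.mem_filter.2
          ⟨Finset.mem_image.2 ⟨_, hσ, Formula.equivSentence.symm_apply_apply φ⟩, hφ⟩
    exact Model.isSatisfiable M
  obtain ⟨N⟩ := hsat
  have hN : N ⊨ (L.lhomWithConstants α).onTheory T := N.is_model.mono Set.subset_union_left
  refine ⟨ModelType.reduct (L.lhomWithConstants α) (Model.bundled hN),
    fun a => (L.con a : N), fun φ hφ => ?_⟩
  let : L.Structure N := (L.lhomWithConstants α).reduct N
  have : (L.lhomWithConstants α).IsExpansionOn N := LHom.isExpansionOn_reduct _ _
  exact (Formula.realize_equivSentence N φ).1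
    (realize_sentence_of_mem ((L.lhomWithConstants α).onTheory T ∪ Formula.equivSentence '' Γ)
      (Set.mem_union_right _ (Set.mem_image_of_mem _ hφ)))

/-- The realizations of a formula depend only on the values of its free variables. -/
theorem _root_.FirstOrder.Language.Formula.realize_congr {M : Type*} [L.Structure M] {α : Type*}
    [DecidableEq α] {φ : L.Formula α} {v w : α → M} (h : ∀ a ∈ φ.freeVarFinset, v a = w a) :
    φ.Realize v ↔ φ.Realize w :=
  (BoundedFormula.realize_restrictFreeVar (f := id) (v := fun a : φ.freeVarFinset => v a) v
    fun _ => rfl).symm.trans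
    (BoundedFormula.realize_restrictFreeVar w fun a => h a a.2)

/-- The existential closure of a formula holds in a nonempty structure if and only if the formula
is realized there. -/
theorem _root_.FirstOrder.Language.Formula.realize_exClosure_iff_exists {M : Type*} [L.Structure M]
    [Nonempty M] {α : Type*} [DecidableEq α] {φ : L.Formula α} :
    M ⊨ φ.exClosure ↔ ∃ v : α → M, φ.Realize v := by
  refine Formula.exists_realize_equivSentence_iff_realize_exClosure.symm.trans
    (exists_congr fun v => ?_)
  have h := Formula.realize_equivSentence_symm M (Formula.equivSentence φ) v
  rwa [_root_.Equiv.symm_apply_apply, Iff.comm] at h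

/-- In a complete theory, validity of a formula can be tested in any model. -/
theorem IsComplete.models_formula_iff {α : Type*} (hT : T.IsComplete) (M : Type*)
    [L.Structure M] [M ⊨ T] [Nonempty M] (φ : L.Formula α) :
    T ⊨ᵇ φ ↔ ∀ v : α → M, φ.Realize v := by
  classical
  refine ⟨fun h v => h.realize_formula M, fun h => Theory.models_formula_iff.2 fun N v => ?_⟩
  by_contra hv
  have hN : N ⊨ φ.not.exClosure := Formula.realize_exClosure_iff_exists.2 ⟨v, hv⟩
  have hM : M ⊨ φ.not.exClosure :=
    (hT.realize_sentence_iff _ M).2 ((hT.realize_sentence_iff _ N).1 hN)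
  obtain ⟨w, hw⟩ := Formula.realize_exClosure_iff_exists.1 hM
  exact hw (h w)

/-- In a complete theory, implications between formulas transfer between models. -/
theorem IsComplete.forall_realize_imp {α : Type*} (hT : T.IsComplete) {M N : Type*}
    [L.Structure M] [M ⊨ T] [Nonempty M] [L.Structure N] [N ⊨ T] [Nonempty N]
    {φ ψ : L.Formula α} (h : ∀ v : α → M, φ.Realize v → ψ.Realize v) (v : α → N)
    (hv : φ.Realize v) : ψ.Realize v :=
  (hT.models_formula_iff N (φ.imp ψ)).1 ((hT.models_formula_iff M (φ.imp ψ)).2 h) v hv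

/-! ### Omitting types -/

/-- The formula obtained from `θ` by existential quantification that defines the set of values
of the tuple of variables `i` under assignments realizing `θ`. -/
theorem exists_formula_realize_iff_exists_comp {M : Type*} [L.Structure M] [Nonempty M] {n : ℕ}
    (θ : L.Formula ℕ) (i : Fin n → ℕ) :
    ∃ χ : L.Formula (Fin n), ∀ a : Fin n → M,
      χ.Realize a ↔ ∃ v : ℕ → M, θ.Realize v ∧ v ∘ i = a := by
  classical
  let s : Finset ℕ := θ.freeVarFinset ∪ Finset.univ.image i
  have hi (k : Fin n) : i k ∈ s := by simp [s]
  let θ' : L.Formula s := θ.restrictFreeVar fun a => ⟨a, Finset.mem_union_left _ a.2⟩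
  let e : L.Formula (Fin n ⊕ s) := Formula.iInf fun k =>
    (Term.var (Sum.inr ⟨i k, hi k⟩)).equal (Term.var (Sum.inl k))
  refine ⟨(θ'.relabel Sum.inr ⊓ e).iExs s, fun a => ?_⟩
  have hθ (v : ℕ → M) : θ'.Realize (fun a : s => v a) ↔ θ.Realize v :=
    BoundedFormula.realize_restrictFreeVar v fun _ => rfl
  rw [Formula.realize_iExs]
  simp only [Formula.realize_inf, Formula.realize_relabel, e, Formula.realize_iInf,
    Formula.realize_equal, Term.realize_var, Sum.elim_inr, Sum.elim_inl, Sum.elim_comp_inr]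
  constructor
  · rintro ⟨u, hu, hua⟩
    let v : ℕ → M := fun j => if hj : j ∈ s then u ⟨j, hj⟩ else Classical.arbitrary M
    have hv : (fun a : s => v a) = u := by
      ext a
      simp [v]
    refine ⟨v, (hθ v).1 (hv ▸ hu), funext fun k => ?_⟩
    rw [← hua k, ← hv]
    rfl
  · rintro ⟨v, hv, rfl⟩
    exact ⟨fun a => v a, (hθ v).2 hv, fun k => rfl⟩

/-- The **Omitting Types Theorem**: if no formula realized in a model `M` of the complete theory
`T` entails all of `p`, then some countable model of `T` omits `p`. -/
theorem IsComplete.exists_countable_model_omitting (hT : T.IsComplete) [Countable L.Symbols]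
    (M : Type*) [L.Structure M] [M ⊨ T] [Nonempty M] {n : ℕ} (p : Set (L.Formula (Fin n)))
    (hp : ∀ χ : L.Formula (Fin n), (∃ a : Fin n → M, χ.Realize a) →
      ∃ a : Fin n → M, χ.Realize a ∧ ∃ ψ ∈ p, ¬ψ.Realize a) :
    ∃ N : ModelType.{u, v, max u v} T, Countable N ∧
      ∀ a : Fin n → N, ∃ ψ ∈ p, ¬ψ.Realize a := by
  classical
  -- Henkin's construction as forcing: the variables play the new constants, and a larger condition
  -- is a stronger formula.
  let P := {θ : L.Formula ℕ // ∃ v : ℕ → M, θ.Realize v}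
  let : Preorder P :=
    { le := fun θ θ' => ∀ v : ℕ → M, θ'.1.Realize v → θ.1.Realize v
      le_refl := fun _ _ h => h
      le_trans := fun _ _ _ h₁ h₂ v h => h₁ v (h₂ v h) }
  -- Conditions deciding whether `φ` has a witness, and naming one.
  let witness (φ : L.Formula (ℕ ⊕ Fin 1)) : Order.Cofinal P :=
    { carrier := {θ | (∀ v : ℕ → M, θ.1.Realize v → (φ.iExs (Fin 1)).not.Realize v) ∨
        ∃ j : ℕ, ∀ v : ℕ → M, θ.1.Realize v →
          (φ.relabel (Sum.elim id fun _ => j)).Realize v}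
      isCofinal := by
        rintro ⟨θ, v, hv⟩
        by_cases hφ : (φ.iExs (Fin 1)).Realize v
        · obtain ⟨x, hx⟩ := (Formula.realize_iExs).1 hφ
          -- A variable `j` fresh for `θ` and `φ` can be reassigned to the witness without affecting
          -- either.
          obtain ⟨j, hj⟩ := Infinite.exists_notMem_finset
            (θ.freeVarFinset ∪ φ.freeVarFinset.toLeft)
          simp only [Finset.mem_union, Finset.mem_toLeft, not_or] at hj
          refine ⟨⟨θ ⊓ φ.relabel (Sum.elim id fun _ => j), Function.update v j (x 0), ?_⟩,
            Or.inr ⟨j, fun w hw => (Formula.realize_inf.1 hw).2⟩,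
            fun w hw => (Formula.realize_inf.1 hw).1⟩
          refine Formula.realize_inf.2 ⟨(Formula.realize_congr fun a ha => ?_).1 hv,
            Formula.realize_relabel.2 ((Formula.realize_congr fun a ha => ?_).1 hx)⟩
          · rw [Function.update_of_ne (ne_of_mem_of_not_mem ha hj.1)]
          · rcases a with a | a
            · have : a ≠ j := by
                rintro rfl
                exact hj.2 ha
              simp [Function.update_of_ne this]
            · simp [Subsingleton.elim a 0]
        · exact ⟨⟨θ ⊓ (φ.iExs (Fin 1)).not, v, Formula.realize_inf.2 ⟨hv, hφ⟩⟩,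
            Or.inl fun w hw => (Formula.realize_inf.1 hw).2,
            fun w hw => (Formula.realize_inf.1 hw).1⟩ }
  -- Conditions ensuring that the tuple `i` does not realize `p`.
  let omitting (i : Fin n → ℕ) : Order.Cofinal P :=
    { carrier := {θ | ∃ ψ ∈ p, ∀ v : ℕ → M, θ.1.Realize v → (ψ.relabel i).not.Realize v}
      isCofinal := by
        rintro ⟨θ, v, hv⟩
        -- `hp` concerns formulas in `n` variables, so `θ` is first projected to the tuple `i`.
        obtain ⟨χ, hχ⟩ := exists_formula_realize_iff_exists_comp (M := M) θ i
        obtain ⟨a, ha, ψ, hψ, hψa⟩ := hp χ ⟨v ∘ i, (hχ _).2 ⟨v, hv, rfl⟩⟩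
        obtain ⟨w, hw, rfl⟩ := (hχ a).1 ha
        exact ⟨⟨θ ⊓ (ψ.relabel i).not, w, Formula.realize_inf.2
            ⟨hw, fun h => hψa (Formula.realize_relabel.1 h)⟩⟩,
          ⟨ψ, hψ, fun v hv => (Formula.realize_inf.1 hv).2⟩,
          fun v hv => (Formula.realize_inf.1 hv).1⟩ }
  let : Encodable (L.Formula (ℕ ⊕ Fin 1) ⊕ (Fin n → ℕ)) := Encodable.ofCountable _
  let G := Order.idealOfCofinals (⟨⊤, fun _ => Classical.arbitrary M, by simp⟩ : P)
    (Sum.elim witness omitting)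
  obtain ⟨N, w, hw⟩ : ∃ (N : ModelType.{u, v, max u v} T) (w : ℕ → N),
      ∀ φ ∈ Subtype.val '' (G : Set P), φ.Realize w := by
    refine exists_realize_of_finitely_realized fun s hs => ?_
    obtain ⟨θ, hθ⟩ : ∃ θ : P, ∀ φ ∈ s, ∀ v : ℕ → M, θ.1.Realize v → φ.Realize v := by
      have : ∃ θ ∈ G, ∀ φ ∈ s, ∀ v : ℕ → M, θ.1.Realize v → φ.Realize v := by
        induction s using Finset.induction_on with
        | empty => exact ⟨_, G.nonempty.some_mem, by simp⟩
        | insert φ s _ ih =>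
          obtain ⟨θ, hθG, hθ⟩ := ih fun ψ hψ => hs ψ (Finset.mem_insert_of_mem hψ)
          obtain ⟨φ', hφ'G, rfl⟩ := hs φ (Finset.mem_insert_self _ _)
          obtain ⟨θ', hθ'G, h₁, h₂⟩ := G.directed _ hθG _ hφ'G
          refine ⟨θ', hθ'G, fun ψ hψ v hv => ?_⟩
          rcases Finset.mem_insert.1 hψ with rfl | hψ
          · exact h₂ v hv
          · exact hθ ψ hψ v (h₁ v hv)
      exact this.imp fun _ h => h.2
    -- `M` may lie in another universe, so realizability is moved to a bundled model by
    -- completeness.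
    obtain ⟨v, hv⟩ : ∃ v : ℕ → hT.1.some, θ.1.Realize v :=
      Formula.realize_exClosure_iff_exists.1 ((hT.realize_sentence_iff _ _).2
        ((hT.realize_sentence_iff _ M).1 (Formula.realize_exClosure_iff_exists.2 θ.2)))
    exact ⟨hT.1.some, v, fun φ hφ => hT.forall_realize_imp (hθ φ hφ) v hv⟩
  -- Tarski–Vaught test: genericity puts a witness for each satisfiable `φ'` among the values of
  -- `w`.
  have hmeets : L.MeetsDefinable (Set.range w) := by
    rintro D ⟨d, hd⟩ hD
    obtain ⟨φ, hφ⟩ := Set.definable_iff_exists_formula_sum.1 hD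
    have hφD (x : N) : x ∈ D ↔ φ.Realize (Sum.elim (↑) ![x]) := by
      have := congrArg (![x] ∈ ·) hφ
      simpa using this
    have hval (a : Set.range w) : w a.2.choose = a := a.2.choose_spec
    let φ' : L.Formula (ℕ ⊕ Fin 1) :=
      φ.relabel (Sum.map (fun a : Set.range w => a.2.choose) id)
    have hφ' (x : Fin 1 → N) : φ'.Realize (Sum.elim w x) ↔ x 0 ∈ D := by
      rw [hφD, Formula.realize_relabel]
      apply iff_of_eq
      congr 1
      ext a
      rcases a with a | a
      · simp [hval]
      · simp [Subsingleton.elim a 0]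
    obtain ⟨θ, hθ, hθG⟩ := Order.cofinal_meets_idealOfCofinals
      (⟨⊤, fun _ => Classical.arbitrary M, by simp⟩ : P) (Sum.elim witness omitting) (Sum.inl φ')
    have hθw : θ.1.Realize w := hw _ ⟨θ, hθG, rfl⟩
    rcases hθ with hθ | ⟨j, hθ⟩
    · exact absurd (Formula.realize_iExs.2 ⟨![d], (hφ' _).2 hd⟩)
        (hT.forall_realize_imp hθ w hθw)
    · refine ⟨w j, (hφ' fun _ => w j).1 ?_, j, rfl⟩
      have := Formula.realize_relabel.1 (hT.forall_realize_imp hθ w hθw)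
      convert this using 1
      ext a
      rcases a with a | a <;> rfl
  let S := hmeets.toElementarySubstructure
  have hS : (S : Set N) = Set.range w := hmeets.closure_eq_self
  refine ⟨S.toModel T, ?_, fun a => ?_⟩
  · change (S : Set N).Countable
    rw [hS]
    exact Set.countable_range w
  · have ha (k : Fin n) : ∃ j, w j = (a k : S).1 := by
      have : (a k : S).1 ∈ (S : Set N) := (a k : S).2
      rwa [hS] at this
    choose i hi using ha
    obtain ⟨θ, ⟨ψ, hψ, hθ⟩, hθG⟩ := Order.cofinal_meets_idealOfCofinals
      (⟨⊤, fun _ => Classical.arbitrary M, by simp⟩ : P) (Sum.elim witness omitting) (Sum.inr i)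
    refine ⟨ψ, hψ, fun h => hT.forall_realize_imp hθ w (hw _ ⟨θ, hθG, rfl⟩) ?_⟩
    refine Formula.realize_relabel.2 ?_
    have := (S.subtype.map_formula ψ a).2 h
    convert this using 1
    ext k
    exact hi k

/-! ### The Ryll-Nardzewski theorem -/

/-- In a countable model of an `ω`-categorical complete theory, the type of every tuple is
isolated by a formula. -/
theorem IsComplete.exists_isolating_formula (hT : T.IsComplete) [Countable L.Symbols]
    (hcat : Cardinal.aleph0.{max u v}.Categorical T) (M : ModelType.{u, v, max u v} T)
    (hM : #M = ℵ₀) {n : ℕ} (a : Fin n → M) :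
    ∃ χ : L.Formula (Fin n), χ.Realize a ∧
      ∀ ψ : L.Formula (Fin n), ψ.Realize a → ∀ b : Fin n → M, χ.Realize b → ψ.Realize b := by
  by_contra! hiso
  obtain ⟨N, hNc, hN⟩ := hT.exists_countable_model_omitting M
    {ψ : L.Formula (Fin n) | ψ.Realize a} (by
      rintro χ ⟨b, hb⟩
      -- If `χ` fails at `a`, then `χ.not` belongs to the type of `a` and fails wherever `χ` holds.
      by_cases hχ : χ.Realize a
      · obtain ⟨ψ, hψ, c, hc, hψc⟩ := hiso χ hχ
        exact ⟨c, hc, ψ, hψ, hψc⟩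
      · exact ⟨b, hb, χ.not, hχ, fun h => h hb⟩)
  have : Infinite M := Cardinal.infinite_iff.2 hM.ge
  have : Infinite N := (hT.models_elementarily_equivalent M N).infinite
  obtain ⟨e⟩ := hcat M N hM (Cardinal.mk_eq_aleph0 N)
  obtain ⟨ψ, hψ, hψN⟩ := hN (e ∘ a)
  exact hψN ((StrongHomClass.realize_formula e ψ).2 hψ)

/-- The **Ryll-Nardzewski Theorem**: in an `ω`-categorical complete theory there are only
finitely many formulas in `n` variables up to equivalence. -/
theorem IsComplete.exists_finite_formulas (hT : T.IsComplete) [Countable L.Symbols]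
    (hcat : Cardinal.aleph0.{max u v}.Categorical T) (n : ℕ) :
    ∃ F : Set (L.Formula (Fin n)), F.Finite ∧ ∀ φ, ∃ ψ ∈ F, T.Iff φ ψ := by
  classical
  -- One representative per value of `g` suffices; `g φ = g ψ` is symmetric, so one implication
  -- gives equivalence.
  suffices h : ∃ (M : ModelType.{u, v, max u v} T) (β : Type max u v) (_ : Finite β)
      (g : L.Formula (Fin n) → β), ∀ φ ψ, g φ = g ψ →
        ∀ a : Fin n → M, φ.Realize a → ψ.Realize a by
    obtain ⟨M, β, _, g, hg⟩ := h
    choose r hr using fun b : Set.range g => b.2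
    exact ⟨Set.range r, Set.finite_range r, fun φ => ⟨r ⟨g φ, φ, rfl⟩, ⟨_, rfl⟩,
      (hT.models_formula_iff M _).2 fun a => Formula.realize_iff.2
        ⟨hg _ _ (hr ⟨g φ, φ, rfl⟩).symm a, hg _ _ (hr ⟨g φ, φ, rfl⟩) a⟩⟩⟩
  obtain ⟨M₀⟩ := hT.1
  rcases finite_or_infinite M₀ with _ | _
  · exact ⟨M₀, Set (Fin n → M₀), inferInstance, fun φ => {a | φ.Realize a},
      fun φ ψ h a => (Set.ext_iff.1 h a).1⟩
  have hL : L.card ≤ ℵ₀ := Cardinal.mk_le_aleph0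
  obtain ⟨M, hM⟩ := exists_model_card_eq ⟨M₀, inferInstance⟩ ℵ₀ le_rfl (by simpa using hL)
  -- `C` consists of the formulas whose realizations in `M` all have the same type.
  let C : Set (L.Formula (Fin n)) := {χ | ∀ ψ : L.Formula (Fin n), ∀ a : Fin n → M,
    χ.Realize a → ψ.Realize a → ∀ b : Fin n → M, χ.Realize b → ψ.Realize b}
  obtain ⟨s, hsC, hs⟩ : ∃ s : Finset (L.Formula (Fin n)), (∀ χ ∈ s, χ ∈ C) ∧
      ∀ a : Fin n → M, ∃ χ ∈ s, χ.Realize a := by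
    -- Otherwise compactness gives a tuple avoiding all of `C`; a countable elementary substructure
    -- containing it is isomorphic to `M`, where its type is isolated by a member of `C`.
    by_contra! hcover
    obtain ⟨N, v, hv⟩ : ∃ (N : ModelType.{u, v, max u v} T) (v : Fin n → N),
        ∀ φ ∈ Formula.not '' C, φ.Realize v := by
      refine exists_realize_of_finitely_realized fun t ht => ?_
      obtain ⟨s, hsC, rfl⟩ := Finset.subset_set_image_iff.1 ht
      obtain ⟨a, ha⟩ := hcover s hsC
      exact ⟨M, a, Finset.forall_mem_image.2 ha⟩
    have : Infinite M := Cardinal.infinite_iff.2 hM.ge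
    have : Infinite N := (hT.models_elementarily_equivalent M N).infinite
    obtain ⟨S, hvS, hS⟩ := exists_elementarySubstructure_card_eq L (Set.range v)
      (ℵ₀ : Cardinal.{max u v}) le_rfl
      (by simp) (by simpa using hL) (by simp)
    have hS' : #S = ℵ₀ := by simpa using hS
    obtain ⟨e⟩ := hcat (S.toModel T) M hS' hM
    let v' : Fin n → S := fun k => ⟨v k, hvS ⟨k, rfl⟩⟩
    obtain ⟨χ, hχ, hiso⟩ := hT.exists_isolating_formula hcat M hM (e ∘ v')
    refine hv χ.not ⟨χ, fun ψ a ha hψ b hb => ?_, rfl⟩ ?_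
    · by_contra hψb
      by_cases h : ψ.Realize (e ∘ v')
      · exact hψb (hiso ψ h b hb)
      · exact hiso (ψ.not) h a ha hψ
    · exact (S.subtype.map_formula χ v').2 ((StrongHomClass.realize_formula e χ).1 hχ)
  -- A formula is determined in `M` by the members of `s` it meets, since it contains each one it
  -- meets.
  refine ⟨M, Set s, inferInstance, fun φ => {χ | ∃ a : Fin n → M, χ.1.Realize a ∧ φ.Realize a},
    fun φ ψ h a ha => ?_⟩
  obtain ⟨χ, hχs, hχ⟩ := hs a
  obtain ⟨b, hb, hψb⟩ := (Set.ext_iff.1 h ⟨χ, hχs⟩).1 ⟨a, hχ, ha⟩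
  exact hsC χ hχs ψ b hb hψb a hχ

/-! ### From `n`-ary to almost unary -/

/-- A Boolean combination of formulas each equivalent to a member of `Δ'` is equivalent to a
Boolean combination of members of `Δ'`. -/
theorem exists_booleanCombination_iff {Δ Δ' : Set (L.Formula ℕ)}
    (h : ∀ φ ∈ Δ, ∃ ψ ∈ Δ', T.Iff φ ψ) {φ : L.Formula ℕ} (hφ : BooleanCombination Δ φ) :
    ∃ ψ, BooleanCombination Δ' ψ ∧ T.Iff φ ψ := by
  induction hφ with
  | of φ hφ =>
    obtain ⟨ψ, hψ, hiff⟩ := h φ hφ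
    exact ⟨ψ, .of ψ hψ, hiff⟩
  | falsum => exact ⟨⊥, .falsum, Iff.refl _⟩
  | not φ _ ih =>
    obtain ⟨ψ, hψ, hiff⟩ := ih
    exact ⟨ψ.not, .not ψ hψ, hiff.not⟩
  | inf φ₁ φ₂ _ _ ih₁ ih₂ =>
    obtain ⟨ψ₁, hψ₁, hiff₁⟩ := ih₁
    obtain ⟨ψ₂, hψ₂, hiff₂⟩ := ih₂
    exact ⟨ψ₁ ⊓ ψ₂, .inf _ _ hψ₁ hψ₂, models_formula_iff.2 fun M v => by
      rw [Formula.realize_iff, Formula.realize_inf, Formula.realize_inf,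
        Formula.realize_iff.1 (models_formula_iff.1 hiff₁ M v),
        Formula.realize_iff.1 (models_formula_iff.1 hiff₂ M v)]⟩
  | sup φ₁ φ₂ _ _ ih₁ ih₂ =>
    obtain ⟨ψ₁, hψ₁, hiff₁⟩ := ih₁
    obtain ⟨ψ₂, hψ₂, hiff₂⟩ := ih₂
    exact ⟨ψ₁ ⊔ ψ₂, .sup _ _ hψ₁ hψ₂, models_formula_iff.2 fun M v => by
      rw [Formula.realize_iff, Formula.realize_sup, Formula.realize_sup,
        Formula.realize_iff.1 (models_formula_iff.1 hiff₁ M v),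
        Formula.realize_iff.1 (models_formula_iff.1 hiff₂ M v)]⟩

/-- A formula with at most `n` free variables is a substitution instance of a formula whose
variables are indexed by `Fin n`. -/
theorem exists_formula_fin_relabel {n : ℕ} {φ : L.Formula ℕ} (hφ : φ.freeVarFinset.card ≤ n) :
    ∃ (ψ : L.Formula (Fin n)) (g : Fin n → ℕ), T.Iff φ (ψ.relabel g) := by
  let f : φ.freeVarFinset → Fin n := fun a => Fin.castLE hφ (φ.freeVarFinset.equivFin a)
  have hf : f.Injective :=
    (Fin.castLE_injective hφ).comp φ.freeVarFinset.equivFin.injective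
  -- `g` inverts `f`; the default `0` is harmless, as indices outside the range of `f` do not occur
  -- in the restricted formula.
  let g : Fin n → ℕ := Function.extend f Subtype.val 0
  refine ⟨φ.restrictFreeVar f, g, models_formula_iff.2 fun M v => ?_⟩
  rw [Formula.realize_iff, Formula.realize_relabel]
  exact (BoundedFormula.realize_restrictFreeVar v fun a => by
    simp [g, hf.extend_apply]).symm

/-- An `ω`-categorical `n`-ary theory in a countable language is almost unary. -/
theorem IsNAry.isAlmostNAry_one_of_categorical [Countable L.Symbols] (hT : T.IsComplete)
    (hcat : Cardinal.aleph0.{max u v}.Categorical T) {n : ℕ} (h : T.IsNAry n) :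
    T.IsAlmostNAry 1 := by
  obtain ⟨F, hF, hFT⟩ := hT.exists_finite_formulas hcat n
  let E : L.Formula ℕ := (Term.var 0).equal (Term.var 1)
  refine ⟨insert E (Formula.relabel Fin.val '' F), (hF.image _).insert _, fun φ => ?_⟩
  obtain ⟨ψ, hψ, hφψ⟩ := h φ
  refine (exists_booleanCombination_iff (fun χ hχ => ?_) hψ).imp
    fun ψ' h => ⟨h.1, hφψ.trans h.2⟩
  rcases hχ with hχ | ⟨-, i, j, rfl⟩
  · obtain ⟨χ', g, hχ'⟩ := exists_formula_fin_relabel (T := T) hχ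
    obtain ⟨δ, hδF, hδ⟩ := hFT χ'
    let f : ℕ → ℕ := Function.extend Fin.val g 0
    refine ⟨(δ.relabel Fin.val).relabel f,
      Or.inr ⟨_, Set.mem_insert_of_mem _ ⟨δ, hδF, rfl⟩, f, rfl⟩, models_formula_iff.2 fun M v => ?_⟩
    have hfg : f ∘ Fin.val = g := Function.extend_comp Fin.val_injective g 0
    have h₁ := Formula.realize_iff.1 (models_formula_iff.1 hχ' M v)
    have h₂ := Formula.realize_iff.1 (models_formula_iff.1 hδ M (v ∘ g))
    rw [Formula.realize_relabel] at h₁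
    rw [Formula.realize_iff, Formula.realize_relabel, Formula.realize_relabel,
      Function.comp_assoc, hfg, h₁, h₂]
  · refine ⟨_, Or.inr ⟨E, Set.mem_insert _ _, fun k => if k = 0 then i else j, rfl⟩,
      models_formula_iff.2 fun M v => ?_⟩
    rw [Formula.realize_iff, Formula.realize_relabel, Formula.realize_equal, Formula.realize_equal]
    rfl

end Theory

end FirstOrder.Language

theorem mainTheorem10 {L L' : FirstOrder.Language.{u, v}} (ι : FirstOrder.Language.LHom L L')
    (T : L.Theory) (T' : L'.Theory) (n : ℕ) (hn : 1 ≤ n)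
    (hcountable : L'.card ≤ Cardinal.aleph0) (hcomplete : T'.IsComplete)
    (hcategorical : Cardinal.aleph0.{max u v}.Categorical T')
    (hnary : T'.IsNAry n) (hrestriction : FirstOrder.Language.Theory.IsRestriction ι T T') :
    T.IsAlmostUnaryTizable := by
  have : Countable L'.Symbols := Cardinal.mk_le_aleph0_iff.1 hcountable
  exact ⟨L', ι, T', hcomplete, hrestriction,
    hnary.isAlmostNAry_one_of_categorical hcomplete hcategorical⟩
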